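/- Let $N^+=\mathbb{Z}_{\ge 0}^2\setminus\{(0,0)\}$ with $\deg(a,b)=a+b$ and the skew-symmetric form $\{(a,b),(c,d)\}=bc-ad$. Let $\mathfrak g=\bigoplus_{n\in N^+}\mathbb{Q}X_n$ be the Lie algebra with bracket $[X_n,X_{n'}]=\{n,n'\}X_{n+n'}$. For $l\ge 0$ let $\mathfrak g^{>l}=\bigoplus_{\deg n>l}\mathbb{Q}X_n$ and $\mathfrak g^{\le l}=\mathfrak g/\mathfrak g^{>l}$, let $G^{\le l}=\{\exp(X)\mid X\in\mathfrak g^{\le l}\}$ be the group whose product is given by the Baker–Campbell–Hausdorff formula (equivalently, exponentials are multiplied in the quotient of the universal enveloping algebra $U(\mathfrak g)$ by its part of degree $>l$), and let $G=\varprojlim G^{\le l}$. For $n\in N^+$ and $c\in\mathbb{Q}$ put $$\Psi[n]^c=\exp\Bigl(c\sum_{j\ge 1}\frac{(-1)^{j+1}}{j^2}X_{jn}\Bigr)\in G .$$ Order $N^+$ totally by: $p\le q$ if and only if $\{p,q\}<0$ or $q=kp$ for some rational $k\ge 1$. For a family $(u_p)_{p\in N^+}$ of rational numbers, the ordered product $\overrightarrow{\prod}_{p\in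 N^+}\Psi[p]^{u_p}\in G$ is the product taken in increasing order of $p$; its image in $G^{\le l}$ is the finite product of the images of the factors with $\deg p\le l$. For all $m,n\in\mathbb{Z}_{\ge 0}$ there is a unique family $(u_p(m,n))_{p\in N^+}$ of rational numbers with $$\Psi[(0,1)]^{n}\,\Psi[(1,0)]^{m}=\overrightarrow{\prod_{p\in N^+}}\Psi[p]^{u_p(m,n)}\quad\text{in } G,$$ and these exponents satisfy the following reciprocity: for all $(a,b)\in N^+$ and all $m,n\in\mathbb{Z}_{\ge 0}$, $$u_{(a,b)}(m,n)=u_{(b,a)}(n,m).$$ -/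

import Mathlib

namespace RankTwoCSD

/-- The set `N⁺ = ℤ_{≥0}² ∖ {(0,0)}`, where `(a, b)` stands for `a e₁ + b e₂`. -/
@[ext]
structure NPlus where
  fst : ℕ
  snd : ℕ
  pos : 0 < fst + snd

namespace NPlus

/-- The degree `deg (a, b) = a + b`. -/
def deg (p : NPlus) : ℕ := p.fst + p.snd

instance : Add NPlus where
  add p q := ⟨p.fst + q.fst, p.snd + q.snd, by have := p.pos; omega⟩

@[simp] theorem add_fst (p q : NPlus) : (p + q).fst = p.fst + q.fst := rfl
@[simp] theorem add_snd (p q : NPlus) : (p + q).snd = p.snd + q.snd := rfl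

/-- The element `(b, a)` for `(a, b)`. -/
def swap (p : NPlus) : NPlus := ⟨p.snd, p.fst, by have := p.pos; omega⟩

/-- The basis vectors `e₁ = (1, 0)` and `e₂ = (0, 1)`. -/
def e₁ : NPlus := ⟨1, 0, by omega⟩
def e₂ : NPlus := ⟨0, 1, by omega⟩

/-- The skew-symmetric form `{(a, b), (c, d)} = b c - a d`, normalized by `{e₂, e₁} = 1`. -/
def form (p q : NPlus) : ℚ := p.snd * q.fst - p.fst * q.snd

/-- The total order on `N⁺`: `p ≤ q` iff `{p, q} < 0`, or `q = k p` for a rational `k ≥ 1`. -/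
instance : LE NPlus where
  le p q := form p q < 0 ∨ ∃ k : ℚ, 1 ≤ k ∧ (q.fst : ℚ) = k * p.fst ∧ (q.snd : ℚ) = k * p.snd

theorem le_def (p q : NPlus) : p ≤ q ↔
    (form p q < 0 ∨ ∃ k : ℚ, 1 ≤ k ∧ (q.fst : ℚ) = k * p.fst ∧ (q.snd : ℚ) = k * p.snd) :=
  Iff.rfl

theorem le_iff (p q : NPlus) : p ≤ q ↔
    (p.snd * q.fst < p.fst * q.snd ∨ (p.snd * q.fst = p.fst * q.snd ∧ p.deg ≤ q.deg)) := by
  rw [le_def]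
  constructor
  · rintro (h | ⟨k, hk, h1, h2⟩)
    · left
      unfold form at h
      have h' : (p.snd : ℚ) * q.fst < p.fst * q.snd := by linarith
      exact_mod_cast h'
    · right
      constructor
      · have : (p.snd : ℚ) * q.fst = p.fst * q.snd := by rw [h1, h2]; ring
        exact_mod_cast this
      · have : (p.fst : ℚ) + p.snd ≤ q.fst + q.snd := by
          rw [h1, h2]
          have h3 : (0 : ℚ) ≤ p.fst := by positivity
          have h4 : (0 : ℚ) ≤ p.snd := by positivity
          nlinarith
        unfold deg
        exact_mod_cast this
  · rintro (h | ⟨h1, h2⟩)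
    · left
      have h' : (p.snd : ℚ) * q.fst < p.fst * q.snd := by exact_mod_cast h
      unfold form
      linarith
    · right
      have hp : (0 : ℚ) < p.fst + p.snd := by exact_mod_cast p.pos
      have h1' : (p.snd : ℚ) * q.fst = p.fst * q.snd := by exact_mod_cast h1
      have h2' : (p.fst : ℚ) + p.snd ≤ q.fst + q.snd := by
        unfold deg at h2
        exact_mod_cast h2
      refine ⟨((q.fst : ℚ) + q.snd) / (p.fst + p.snd), ?_, ?_, ?_⟩
      · rw [le_div_iff₀ hp]
        linarith
      · rw [div_mul_eq_mul_div, eq_div_iff hp.ne']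
        linarith
      · rw [div_mul_eq_mul_div, eq_div_iff hp.ne']
        linarith

theorem le_trans' {p q r : NPlus} (h1 : p ≤ q) (h2 : q ≤ r) : p ≤ r := by
  rw [le_iff] at *
  have hp := p.pos
  have hq := q.pos
  have hr := r.pos
  unfold deg at *
  by_cases hq1 : q.fst = 0
  · have hq2 : 0 < q.snd := by omega
    rw [hq1] at h1 h2
    have hr1 : r.fst = 0 := by
      by_contra hne
      have : 0 < q.snd * r.fst := by positivity
      omega
    rw [hr1] at h2 ⊢
    by_cases hp1 : p.fst = 0
    · rw [hp1] at h1 ⊢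
      omega
    · left
      have : 0 < p.fst * r.snd := by
        have : 0 < r.snd := by omega
        positivity
      omega
  · have hq1' : 0 < q.fst := by omega
    have key1 : p.snd * q.fst ≤ p.fst * q.snd := by omega
    have key2 : q.snd * r.fst ≤ q.fst * r.snd := by omega
    have hp1 : 0 < p.fst := by
      by_contra hne
      have h0 : p.fst = 0 := by omega
      have : 0 < p.snd * q.fst := by
        have : 0 < p.snd := by omega
        positivity
      rw [h0] at key1
      omega
    have a1 : q.fst * (p.snd * r.fst) ≤ p.fst * q.snd * r.fst := by nlinarith
    have a2 : p.fst * q.snd * r.fst ≤ q.fst * (p.fst * r.snd) := by nlinarith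
    rcases h1 with h1 | ⟨h1, h1'⟩
    · rcases h2 with h2 | ⟨h2, h2'⟩
      · left
        have a2' : p.fst * q.snd * r.fst < q.fst * (p.fst * r.snd) := by nlinarith
        exact lt_of_mul_lt_mul_left (a1.trans_lt a2') (Nat.zero_le _)
      · left
        have hr1 : 0 < r.fst := by
          by_contra hne
          have h0 : r.fst = 0 := by omega
          have : 0 < q.fst * r.snd := by
            have : 0 < r.snd := by omega
            positivity
          rw [h0] at h2
          omega
        have a1' : q.fst * (p.snd * r.fst) < p.fst * q.snd * r.fst := by nlinarith
        exact lt_of_mul_lt_mul_left (a1'.trans_le a2) (Nat.zero_le _)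
    · rcases h2 with h2 | ⟨h2, h2'⟩
      · left
        have a2' : p.fst * q.snd * r.fst < q.fst * (p.fst * r.snd) := by nlinarith
        exact lt_of_mul_lt_mul_left (a1.trans_lt a2') (Nat.zero_le _)
      · right
        refine ⟨?_, h1'.trans h2'⟩
        apply Nat.eq_of_mul_eq_mul_left hq1'
        calc q.fst * (p.snd * r.fst) = p.snd * q.fst * r.fst := by ring
          _ = p.fst * (q.snd * r.fst) := by rw [h1]; ring
          _ = q.fst * (p.fst * r.snd) := by rw [h2]; ring

theorem le_antisymm' {p q : NPlus} (h1 : p ≤ q) (h2 : q ≤ p) : p = q := by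
  rw [le_iff] at *
  have c1 : q.snd * p.fst = p.fst * q.snd := mul_comm _ _
  have c2 : q.fst * p.snd = p.snd * q.fst := mul_comm _ _
  have hp := p.pos
  have hd : p.deg = q.deg := by omega
  have he : p.snd * q.fst = p.fst * q.snd := by omega
  unfold deg at hd
  have hf : p.fst = q.fst := by
    have h : (p.fst + p.snd) * p.fst = (p.fst + p.snd) * q.fst := by
      calc (p.fst + p.snd) * p.fst = p.fst * (q.fst + q.snd) := by rw [hd]; ring
        _ = p.fst * q.fst + p.fst * q.snd := by ring
        _ = p.fst * q.fst + p.snd * q.fst := by rw [he]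
        _ = (p.fst + p.snd) * q.fst := by ring
    exact Nat.eq_of_mul_eq_mul_left hp h
  ext
  · exact hf
  · omega

noncomputable instance : LinearOrder NPlus where
  le_refl p := by rw [le_iff]; exact Or.inr ⟨mul_comm _ _, le_rfl⟩
  le_trans _ _ _ h1 h2 := le_trans' h1 h2
  le_antisymm _ _ h1 h2 := le_antisymm' h1 h2
  le_total p q := by
    rw [le_iff, le_iff]
    have c1 : q.snd * p.fst = p.fst * q.snd := mul_comm _ _
    have c2 : q.fst * p.snd = p.snd * q.fst := mul_comm _ _
    omega
  toDecidableLE := Classical.decRel _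

/-- The finite set `(N⁺)^{≤ l}` of elements of degree at most `l`. -/
noncomputable def degLE (l : ℕ) : Finset NPlus :=
  ((Finset.range (l + 1) ×ˢ Finset.range (l + 1)).filter
      fun x => 0 < x.1 + x.2 ∧ x.1 + x.2 ≤ l).attach.image
    fun x => ⟨x.1.1, x.1.2, (Finset.mem_filter.1 x.2).2.1⟩

@[simp] theorem mem_degLE {l : ℕ} {p : NPlus} : p ∈ degLE l ↔ p.deg ≤ l := by
  unfold degLE
  rw [Finset.mem_image]
  constructor
  · rintro ⟨x, -, rfl⟩
    exact (Finset.mem_filter.1 x.2).2.2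
  · intro h
    have hp := p.pos
    unfold deg at h
    refine ⟨⟨(p.fst, p.snd), ?_⟩, Finset.mem_attach _ _, rfl⟩
    rw [Finset.mem_filter, Finset.mem_product, Finset.mem_range, Finset.mem_range]
    exact ⟨⟨by show p.fst < _; omega, by show p.snd < _; omega⟩, hp, h⟩

end NPlus

noncomputable section

/-- The underlying vector space `⨁_{n ∈ N⁺} ℚ X_n` of the Lie algebra `𝔤`. -/
def LieAlg : Type := NPlus →₀ ℚ

instance : AddCommGroup LieAlg := inferInstanceAs (AddCommGroup (NPlus →₀ ℚ))
instance : Module ℚ LieAlg := inferInstanceAs (Module ℚ (NPlus →₀ ℚ))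

/-- The generator `X_n` of `𝔤`. -/
def X (n : NPlus) : LieAlg := Finsupp.single n (1 : ℚ)

/-- The linear map on `𝔤` with `X_n ↦ v n`. -/
def LieAlg.extend {M : Type*} [AddCommGroup M] [Module ℚ M] (v : NPlus → M) : LieAlg →ₗ[ℚ] M :=
  (Finsupp.linearCombination ℚ v : (NPlus →₀ ℚ) →ₗ[ℚ] M)

theorem LieAlg.extend_X {M : Type*} [AddCommGroup M] [Module ℚ M] (v : NPlus → M) (n : NPlus) :
    LieAlg.extend v (X n) = v n :=
  (Finsupp.linearCombination_single ℚ (1 : ℚ) n).trans (one_smul ℚ (v n))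

/-- The bilinear extension of `[X_n, X_{n'}] = {n, n'} X_{n + n'}`. -/
def bracket : LieAlg →ₗ[ℚ] LieAlg →ₗ[ℚ] LieAlg :=
  LieAlg.extend fun n => LieAlg.extend fun n' => NPlus.form n n' • X (n + n')

theorem bracket_X (n n' : NPlus) : bracket (X n) (X n') = NPlus.form n n' • X (n + n') := by
  rw [bracket, LieAlg.extend_X, LieAlg.extend_X]

theorem LieAlg.induction {P : LieAlg → Prop} (x : LieAlg) (zero : P 0)
    (add : ∀ x y, P x → P y → P (x + y)) (smul : ∀ (c : ℚ) (n : NPlus), P (c • X n)) : P x := by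
  refine Finsupp.induction_linear (motive := P) x zero add fun n c => ?_
  have h : (Finsupp.single n c : NPlus →₀ ℚ) = c • Finsupp.single n (1 : ℚ) := by simp
  rw [h]
  exact smul c n

theorem bracket_skew (x y : LieAlg) : bracket x y = -bracket y x := by
  induction x using LieAlg.induction with
  | zero => simp
  | add a b ha hb => rw [map_add, map_add, LinearMap.add_apply, ha, hb]; abel
  | smul c n =>
  induction y using LieAlg.induction with
  | zero => simp
  | add a b ha hb => rw [map_add, map_add, LinearMap.add_apply, ha, hb]; abel
  | smul d p =>
  simp only [map_smul, LinearMap.smul_apply, bracket_X]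
  have h1 : p + n = n + p := by ext <;> simp [add_comm]
  rw [h1, smul_smul, smul_smul, smul_smul, smul_smul, ← neg_smul]
  congr 1
  unfold NPlus.form
  ring

theorem bracket_jacobi (x y z : LieAlg) :
    bracket x (bracket y z) = bracket (bracket x y) z + bracket y (bracket x z) := by
  induction x using LieAlg.induction with
  | zero => simp
  | add a b ha hb => simp only [map_add, LinearMap.add_apply, ha, hb]; abel
  | smul c n =>
  induction y using LieAlg.induction with
  | zero => simp
  | add a b ha hb => simp only [map_add, LinearMap.add_apply, ha, hb]; abel
  | smul d p =>
  induction z using LieAlg.induction with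
  | zero => simp
  | add a b ha hb => simp only [map_add, ha, hb]; abel
  | smul e q =>
  simp only [map_smul, LinearMap.smul_apply, bracket_X]
  have h1 : n + p + q = n + (p + q) := by ext <;> simp [add_assoc]
  have h2 : p + (n + q) = n + (p + q) := by ext <;> simp [add_left_comm]
  rw [h1, h2]
  simp only [smul_smul, ← add_smul]
  congr 1
  unfold NPlus.form
  simp only [NPlus.add_fst, NPlus.add_snd]
  push_cast
  ring

instance : LieRing LieAlg where
  bracket x y := bracket x y
  add_lie x y z := by show bracket (x + y) z = _; rw [map_add]; rfl
  lie_add x y z := map_add (bracket x) y z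
  lie_self x := by
    have h := bracket_skew x x
    have h2 : (2 : ℚ) • bracket x x = 0 := by
      rw [two_smul]
      nth_rewrite 1 [h]
      exact neg_add_cancel _
    exact (smul_eq_zero.1 h2).resolve_left (by norm_num)
  leibniz_lie x y z := bracket_jacobi x y z

instance : LieAlgebra ℚ LieAlg where
  lie_smul c x y := map_smul (bracket x) c y

theorem lie_X (n n' : NPlus) : ⁅X n, X n'⁆ = NPlus.form n n' • X (n + n') := bracket_X n n'

/-- The universal enveloping algebra `U(𝔤)`; it is graded by `deg X_n = deg n`. -/
abbrev U : Type := UniversalEnvelopingAlgebra ℚ LieAlg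

/-- The product `X_{n_1} ⋯ X_{n_k}` in `U(𝔤)`. -/
def monomial (ns : List NPlus) : U :=
  (ns.map fun n => UniversalEnvelopingAlgebra.ι ℚ (X n)).prod

/-- The relations `X_{n_1} ⋯ X_{n_k} = 0` for `deg n_1 + ⋯ + deg n_k > l`. -/
inductive TruncRel (l : ℕ) : U → U → Prop
  | mk (ns : List NPlus) (h : l < (ns.map NPlus.deg).sum) : TruncRel l (monomial ns) 0

/-- The truncation `U(𝔤) / U(𝔤)^{> l}`. The algebras `A l` form an inverse system whose limit is
the completion of `U(𝔤)` with respect to the degree. The Lie algebra `𝔤^{≤ l} = 𝔤 / 𝔤^{> l}` sits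
inside `A l` as the image of `𝔤`, and it is in the algebra `A l` that exponentials of elements of
`𝔤^{≤ l}` are multiplied: the Baker-Campbell-Hausdorff product of `x` and `y` is the element
`z` of `𝔤^{≤ l}` with `exp x * exp y = exp z` in `A l`. -/
abbrev A (l : ℕ) : Type := RingQuot (TruncRel l)

/-- The canonical map `𝔤 → 𝔤^{≤ l} ⊆ A l`. -/
def toA (l : ℕ) : LieAlg →ₗ[ℚ] A l where
  toFun x := RingQuot.mkAlgHom ℚ (TruncRel l) (UniversalEnvelopingAlgebra.ι ℚ x)
  map_add' x y := by rw [map_add, map_add]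
  map_smul' c x := by rw [map_smul, map_smul, RingHom.id_apply]

theorem toA_apply (l : ℕ) (x : LieAlg) :
    toA l x = RingQuot.mkAlgHom ℚ (TruncRel l) (UniversalEnvelopingAlgebra.ι ℚ x) := rfl

theorem prod_toA_X (l : ℕ) (ns : List NPlus) (h : l < (ns.map NPlus.deg).sum) :
    (ns.map fun n => toA l (X n)).prod = 0 := by
  have h1 := RingQuot.mkAlgHom_rel ℚ (TruncRel.mk ns h)
  rw [map_zero, monomial, map_list_prod, List.map_map] at h1
  exact h1

theorem prod_toA (l : ℕ) (xs : List LieAlg) : ∀ ns : List NPlus,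
    l < (ns.map NPlus.deg).sum + xs.length →
    (ns.map fun n => toA l (X n)).prod * (xs.map (toA l)).prod = 0 := by
  induction xs with
  | nil =>
    intro ns h
    rw [prod_toA_X l ns (by simpa using h), zero_mul]
  | cons x xs ih =>
    intro ns h
    rw [List.map_cons, List.prod_cons]
    induction x using LieAlg.induction with
    | zero => simp
    | add a b ha hb => rw [map_add, add_mul, mul_add, ha (by simpa using h), hb (by simpa using h),
        add_zero]
    | smul c n =>
      have h1 := ih (ns ++ [n]) (by
        have hn : 0 < n.deg := n.pos
        simp only [List.map_append, List.sum_append, List.map_cons, List.map_nil, List.sum_cons,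
          List.sum_nil, List.length_cons] at h ⊢
        omega)
      simp only [List.map_append, List.prod_append, List.map_cons, List.map_nil,
        List.prod_cons, List.prod_nil, mul_one] at h1
      rw [map_smul, smul_mul_assoc, mul_smul_comm, ← mul_assoc, h1, smul_zero]

theorem isNilpotent_toA (l : ℕ) (x : LieAlg) : IsNilpotent (toA l x) := by
  refine ⟨l + 1, ?_⟩
  have h := prod_toA l (List.replicate (l + 1) x) [] (by simp)
  simpa using h

/-- The element `exp x` of the group of units of `A l`, for (the class in `𝔤^{≤ l}` of) `x`. -/
def expLE (l : ℕ) (x : LieAlg) : (A l)ˣ where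
  val := IsNilpotent.exp (toA l x)
  inv := IsNilpotent.exp (-toA l x)
  val_inv := IsNilpotent.exp_mul_exp_neg_self (isNilpotent_toA l x)
  inv_val := IsNilpotent.exp_neg_mul_exp_self (isNilpotent_toA l x)

/-- The group `G^{≤ l}` of the exponentials `exp x`, `x ∈ 𝔤^{≤ l}`. (By the
Baker-Campbell-Hausdorff theorem the exponentials are closed under multiplication, so that the
subgroup generated by them consists of exponentials only.) -/
def GLE (l : ℕ) : Subgroup (A l)ˣ := Subgroup.closure (Set.range (expLE l))

/-- The canonical projection `A l' → A l` for `l ≤ l'`. -/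
def transA {l l' : ℕ} (h : l ≤ l') : A l' →ₐ[ℚ] A l :=
  RingQuot.liftAlgHom ℚ ⟨RingQuot.mkAlgHom ℚ (TruncRel l), by
    rintro _ _ ⟨ns, hns⟩
    exact RingQuot.mkAlgHom_rel ℚ (TruncRel.mk ns (h.trans_lt hns))⟩

theorem transA_toA {l l' : ℕ} (h : l ≤ l') (x : LieAlg) : transA h (toA l' x) = toA l x := by
  rw [toA_apply, toA_apply, transA, RingQuot.liftAlgHom_mkAlgHom_apply]

/-- The structure group `G`, the inverse limit of the groups `G^{≤ l}`. -/
def G : Subgroup (∀ l, (A l)ˣ) where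
  carrier := {g | (∀ l, g l ∈ GLE l) ∧
    ∀ (l l' : ℕ) (h : l ≤ l'), Units.map (transA h : A l' →* A l) (g l') = g l}
  one_mem' := ⟨fun l => one_mem _, fun l l' h => map_one _⟩
  mul_mem' := fun hg hg' => ⟨fun l => mul_mem (hg.1 l) (hg'.1 l), fun l l' h => by
    rw [Pi.mul_apply, map_mul, hg.2 l l' h, hg'.2 l l' h, Pi.mul_apply]⟩
  inv_mem' := fun hg => ⟨fun l => inv_mem (hg.1 l), fun l l' h => by
    rw [Pi.inv_apply, map_inv, hg.2 l l' h, Pi.inv_apply]⟩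

/-- The canonical projection `π_l : G → G^{≤ l}`. -/
def proj (l : ℕ) : G →* GLE l where
  toFun g := ⟨g.1 l, g.2.1 l⟩
  map_one' := rfl
  map_mul' _ _ := rfl

/-- The part of degree at most `l` of an element `∑ c_n X_n` of the completion
`∏_{n ∈ N⁺} ℚ X_n` of `𝔤`, which is written as the family of its coefficients. -/
def trunc (l : ℕ) (c : NPlus → ℚ) : LieAlg := ∑ n ∈ NPlus.degLE l, c n • X n

theorem toA_trunc {l l' : ℕ} (h : l ≤ l') (c : NPlus → ℚ) :
    toA l (trunc l' c) = toA l (trunc l c) := by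
  unfold trunc
  rw [map_sum, map_sum]
  symm
  apply Finset.sum_subset
  · intro n hn
    rw [NPlus.mem_degLE] at *
    exact hn.trans h
  · intro n _ hn
    rw [NPlus.mem_degLE, not_le] at hn
    have h1 := prod_toA_X l [n] (by simpa using hn)
    have h2 : toA l (X n) = 0 := by simpa using h1
    rw [map_smul, h2, smul_zero]

/-- The element `exp (∑_n c_n X_n)` of `G`, for an arbitrary family of coefficients `c`. -/
def exp (c : NPlus → ℚ) : G :=
  ⟨fun l => expLE l (trunc l c), fun l => Subgroup.subset_closure ⟨_, rfl⟩, fun l l' h => by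
    apply Units.ext
    show transA h (IsNilpotent.exp (toA l' (trunc l' c))) = IsNilpotent.exp (toA l (trunc l c))
    rw [IsNilpotent.map_exp (isNilpotent_toA _ _), transA_toA, toA_trunc h]⟩

open Classical in
/-- The coefficients of `∑_{j ≥ 1} (-1)^{j+1} / j² X_{j n}`: the coefficient at `p` is
`(-1)^{j+1} / j²` if `p = j n` for some (then unique) `j ≥ 1`, and `0` otherwise. -/
def dilogSeries (n p : NPlus) : ℚ :=
  if h : ∃ j : ℕ, p.fst = j * n.fst ∧ p.snd = j * n.snd then
    (-1) ^ (h.choose + 1) / (h.choose : ℚ) ^ 2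
  else 0

/-- The rational power `Ψ[n]^c = exp (c ∑_{j ≥ 1} (-1)^{j+1} / j² X_{j n})` of the dilogarithm
element `Ψ[n]`. -/
def dilogPow (n : NPlus) (c : ℚ) : G := exp fun p => c * dilogSeries n p

/-- `g` is equal to the ordered product `∏→ Ψ[p]^{u p}` over all `p ∈ N⁺`, in increasing order of
`p`. An infinite product is understood as a limit: in each `G^{≤ l}`, where `Ψ[p]` is trivial for
`deg p > l`, the image of `g` is the product over the finitely many `p` with `deg p ≤ l`. -/
def IsOrderedProduct (g : G) (u : NPlus → ℚ) : Prop :=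
  ∀ l : ℕ, proj l g =
    (((NPlus.degLE l).sort (· ≤ ·)).map fun p => proj l (dilogPow p (u p))).prod

/-- The anti-ordered product `Ψ[(0, 1)]^n Ψ[(1, 0)]^m`. -/
def antiOrdered (m n : ℕ) : G := dilogPow NPlus.e₂ n * dilogPow NPlus.e₁ m

open Classical in
/-- The exponent `u_p(m, n)` of `Ψ[p]` in the ordered product that is equal to
`Ψ[(0, 1)]^n Ψ[(1, 0)]^m`. -/
def exponent (p : NPlus) (m n : ℕ) : ℚ :=
  if h : ∃ u : NPlus → ℚ, IsOrderedProduct (antiOrdered m n) u then h.choose p else 0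

end

end RankTwoCSD

namespace RankTwoCSD

noncomputable section

-- Universal property of `A l`

attribute [local instance] LieRing.ofAssociativeRing

/-! Existence and uniqueness go degree by degree, in the truncated enveloping algebras `A l`. The
kernel of `A (l + 1) → A l` has pure degree `l + 1` and is annihilated by every `X n`
(`mem_topPart_of_transA_eq_zero`), so the factors of degree `l + 1` enter an ordered product only
through the additive term `∑ u_p X_p` (`ordProd_succ`). The new exponents are thus the coefficients
of the discrepancy between the target and the ordered product found so far, provided that this
discrepancy lies in `𝔤`. They are unique because the `X p` with `deg p ≤ l` are linearly independent
in `A l` (`coeff_eq_zero_of_toA_sum_eq_zero`).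

That the discrepancy lies in `𝔤` would follow from Baker–Campbell–Hausdorff; a logarithmic
derivative replaces it here. Let `D` be the derivation multiplying degree `d` by `d`. The units `g`
that normalize `𝔤` and satisfy `D g * g⁻¹ ∈ 𝔤` form a group (`logDerSubgroup`) containing all
`Ψ[p]^c`. If such a unit of `G^{≤ l+1}` is `1 + y` with `y` in the kernel, then `D g * g⁻¹ = (l + 1)
y`, hence `y ∈ 𝔤`.

Reciprocity comes from the anti-automorphism `X n ↦ X (swap n)`. Swapping coordinates negates the
form and thus reverses the order of rays; reversing products restores it. Factors on one ray
commute, so ordered products go to ordered products, and uniqueness identifies the exponents. -/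

theorem hom_ext_A {l : ℕ} {B : Type*} [Ring B] [Algebra ℚ B] {f g : A l →ₐ[ℚ] B}
    (h : ∀ n, f (toA l (X n)) = g (toA l (X n))) : f = g := by
  apply RingQuot.ringQuot_ext'
  apply UniversalEnvelopingAlgebra.hom_ext
  ext x
  show f (toA l x) = g (toA l x)
  induction x using LieAlg.induction with
  | zero => simp
  | add a b ha hb => simp only [map_add, ha, hb]
  | smul c n => simp only [map_smul, h]

/-- The Lie algebra morphism `X n ↦ v n`, for `v` satisfying the commutation relations. -/
def lieHomOfRel {B : Type*} [Ring B] [Algebra ℚ B] (v : NPlus → B)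
    (hv : ∀ n m, v n * v m - v m * v n = NPlus.form n m • v (n + m)) : LieAlg →ₗ⁅ℚ⁆ B where
  __ := LieAlg.extend v
  map_lie' := by
    intro x y
    show LieAlg.extend v ⁅x, y⁆ = ⁅LieAlg.extend v x, LieAlg.extend v y⁆
    induction x using LieAlg.induction with
    | zero => simp
    | add a b ha hb => simp only [map_add, add_lie, ha, hb]
    | smul c n =>
    induction y using LieAlg.induction with
    | zero => simp
    | add a b ha hb => simp only [map_add, lie_add, ha, hb]
    | smul d m =>
      simp only [map_smul, smul_lie, lie_smul, lie_X, LieAlg.extend_X,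
        LieRing.of_associative_ring_bracket, smul_mul_assoc, mul_smul_comm]
      rw [← hv, smul_sub, smul_sub, smul_comm d c (v m * v n)]

/-- The algebra morphism `A l → B` with `X n ↦ v n`, for `v` satisfying the commutation
relations and killing the products of degree `> l`. -/
def liftA {l : ℕ} {B : Type*} [Ring B] [Algebra ℚ B] (v : NPlus → B)
    (hv : ∀ n m, v n * v m - v m * v n = NPlus.form n m • v (n + m))
    (hz : ∀ ns : List NPlus, l < (ns.map NPlus.deg).sum → (ns.map v).prod = 0) : A l →ₐ[ℚ] B :=
  RingQuot.liftAlgHom ℚ ⟨UniversalEnvelopingAlgebra.lift ℚ (lieHomOfRel v hv), by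
    rintro _ _ ⟨ns, hns⟩
    rw [map_zero, monomial, map_list_prod, List.map_map, ← hz ns hns]
    congr 1
    apply List.map_congr_left
    intro n _
    rw [Function.comp_apply, UniversalEnvelopingAlgebra.lift_ι_apply]
    exact LieAlg.extend_X v n⟩

theorem liftA_X {l : ℕ} {B : Type*} [Ring B] [Algebra ℚ B] (v : NPlus → B)
    (hv : ∀ n m, v n * v m - v m * v n = NPlus.form n m • v (n + m))
    (hz : ∀ ns : List NPlus, l < (ns.map NPlus.deg).sum → (ns.map v).prod = 0) (n : NPlus) :
    liftA v hv hz (toA l (X n)) = v n := by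
  rw [liftA, toA_apply, RingQuot.liftAlgHom_mkAlgHom_apply,
    UniversalEnvelopingAlgebra.lift_ι_apply]
  exact LieAlg.extend_X v n

theorem toA_lie (l : ℕ) (x y : LieAlg) :
    toA l ⁅x, y⁆ = toA l x * toA l y - toA l y * toA l x := by
  simp only [toA_apply, LieHom.map_lie, LieRing.of_associative_ring_bracket, map_sub, map_mul]

theorem toA_X_commutator (l : ℕ) (n m : NPlus) :
    toA l (X n) * toA l (X m) - toA l (X m) * toA l (X n) =
      NPlus.form n m • toA l (X (n + m)) := by
  rw [← toA_lie, lie_X, map_smul]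

theorem toA_X_eq_zero {l : ℕ} {n : NPlus} (h : l < n.deg) : toA l (X n) = 0 := by
  simpa using prod_toA_X l [n] (by simpa using h)

/-- The subalgebra satisfies the defining relations of `A l`, so `A l` maps to it; composed with the
inclusion this map fixes the generators, hence is the identity. -/
theorem adjoin_toA_X (l : ℕ) : Algebra.adjoin ℚ (Set.range fun n => toA l (X n)) = ⊤ := by
  set S := Algebra.adjoin ℚ (Set.range fun n => toA l (X n)) with hS
  let v : NPlus → S := fun n => ⟨toA l (X n), Algebra.subset_adjoin ⟨n, rfl⟩⟩
  let f : A l →ₐ[ℚ] S := liftA v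
    (fun n m => Subtype.ext (toA_X_commutator l n m))
    (fun ns h => by
      apply Subtype.ext
      show S.val _ = 0
      rw [map_list_prod, List.map_map]
      exact prod_toA_X l ns h)
  have h : S.val.comp f = AlgHom.id ℚ (A l) := hom_ext_A fun n => by
    show S.val (liftA v _ _ _) = _
    rw [liftA_X]; rfl
  rw [eq_top_iff]
  intro a _
  have h1 := DFunLike.congr_fun h a
  have h2 : S.val (f a) = a := h1
  rw [← h2]
  exact (f a).2

theorem mul_mem_of_mul_X_mem {l : ℕ} (I : Submodule ℚ (A l))
    (h : ∀ y ∈ I, ∀ n, y * toA l (X n) ∈ I) {y : A l} (hy : y ∈ I) (a : A l) : y * a ∈ I := by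
  have ha : a ∈ Algebra.adjoin ℚ (Set.range fun n => toA l (X n)) := by
    rw [adjoin_toA_X]; trivial
  induction ha using Algebra.adjoin_induction generalizing y with
  | mem x hx => obtain ⟨n, rfl⟩ := hx; exact h y hy n
  | algebraMap r =>
    rw [← Algebra.commutes, ← Algebra.smul_def]
    exact I.smul_mem r hy
  | add a b _ _ ha hb => rw [mul_add]; exact I.add_mem (ha hy) (hb hy)
  | mul a b _ _ ha hb => rw [← mul_assoc]; exact hb (ha hy)

theorem mul_mem_of_X_mul_mem {l : ℕ} (I : Submodule ℚ (A l))
    (h : ∀ y ∈ I, ∀ n, toA l (X n) * y ∈ I) {y : A l} (hy : y ∈ I) (a : A l) : a * y ∈ I := by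
  have ha : a ∈ Algebra.adjoin ℚ (Set.range fun n => toA l (X n)) := by
    rw [adjoin_toA_X]; trivial
  induction ha using Algebra.adjoin_induction generalizing y with
  | mem x hx => obtain ⟨n, rfl⟩ := hx; exact h y hy n
  | algebraMap r =>
    rw [← Algebra.smul_def]
    exact I.smul_mem r hy
  | add a b _ _ ha hb => rw [add_mul]; exact I.add_mem (ha hy) (hb hy)
  | mul a b _ _ ha hb => rw [mul_assoc]; exact ha (hb hy)

/-! ### Linear independence of the generators of degree at most `l` -/

/-- The action of `X n` on `⨁ ℚ X_q`, truncated to degree `≤ l + 1`. -/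
def truncAd (l : ℕ) (n : NPlus) : Module.End ℚ LieAlg :=
  LieAlg.extend fun q => if (n + q).deg ≤ l + 1 then NPlus.form n q • X (n + q) else 0

theorem NPlus.deg_add (p q : NPlus) : (p + q).deg = p.deg + q.deg := by
  simp only [NPlus.deg, NPlus.add_fst, NPlus.add_snd]; omega

theorem NPlus.deg_pos (p : NPlus) : 0 < p.deg := p.pos

theorem truncAd_X (l : ℕ) (n q : NPlus) : truncAd l n (X q) =
    if (n + q).deg ≤ l + 1 then NPlus.form n q • X (n + q) else 0 :=
  LieAlg.extend_X _ _

theorem LieAlg.linearMap_ext {M : Type*} [AddCommGroup M] [Module ℚ M] {f g : LieAlg →ₗ[ℚ] M}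
    (h : ∀ n, f (X n) = g (X n)) : f = g := by
  ext x
  induction x using LieAlg.induction with
  | zero => simp
  | add a b ha hb => simp only [map_add, ha, hb]
  | smul c n => simp only [map_smul, h]

/-- This is the Jacobi identity. Since degrees are positive, a term whose final degree survives the
truncation has also survived at the intermediate stage. -/
theorem truncAd_commutator (l : ℕ) (n m : NPlus) :
    truncAd l n * truncAd l m - truncAd l m * truncAd l n =
      NPlus.form n m • truncAd l (n + m) := by
  apply LieAlg.linearMap_ext
  intro q
  simp only [LinearMap.sub_apply, Module.End.mul_apply, LinearMap.smul_apply, truncAd_X]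
  have h1 : m + (n + q) = n + (m + q) := by ext <;> simp [add_left_comm]
  have h2 : n + m + q = n + (m + q) := by ext <;> simp [add_assoc]
  have := n.deg_pos
  have := m.deg_pos
  by_cases h : (n + (m + q)).deg ≤ l + 1
  · have h3 : (m + q).deg ≤ l + 1 := by rw [NPlus.deg_add] at h; omega
    have h4 : (n + q).deg ≤ l + 1 := by simp only [NPlus.deg_add] at h ⊢; omega
    simp only [if_pos h3, if_pos h4, map_smul, truncAd_X, h1, h2, if_pos h, smul_smul, ← sub_smul]
    congr 1
    unfold NPlus.form
    simp only [NPlus.add_fst, NPlus.add_snd]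
    push_cast
    ring
  · rw [h2, if_neg h, smul_zero]
    have key : ∀ a b : NPlus, a + (b + q) = n + (m + q) → truncAd l a
        (if (b + q).deg ≤ l + 1 then NPlus.form b q • X (b + q) else 0) = 0 := by
      intro a b hab
      split_ifs
      · rw [map_smul, truncAd_X, hab, if_neg h, smul_zero]
      · rw [map_zero]
    rw [key n m rfl, key m n h1, sub_zero]

theorem truncAd_prod (l : ℕ) (ns : List NPlus) (q : NPlus) :
    ∃ (c : ℚ) (p : NPlus), (ns.map (truncAd l)).prod (X q) = c • X p ∧
      (c ≠ 0 → p.deg = (ns.map NPlus.deg).sum + q.deg ∧ (ns ≠ [] → p.deg ≤ l + 1)) := by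
  induction ns with
  | nil => exact ⟨1, q, by simp, by simp⟩
  | cons n ns ih =>
    obtain ⟨c, p, h1, h2⟩ := ih
    simp only [List.map_cons, List.prod_cons, Module.End.mul_apply, h1, map_smul, truncAd_X,
      List.sum_cons]
    by_cases h : (n + p).deg ≤ l + 1
    · refine ⟨c * NPlus.form n p, n + p, by rw [if_pos h, smul_smul], fun hc => ?_⟩
      have := (h2 (left_ne_zero_of_mul hc)).1
      exact ⟨by rw [NPlus.deg_add]; omega, fun _ => h⟩
    · exact ⟨0, p, by rw [if_neg h, smul_zero, zero_smul], fun hc => (hc rfl).elim⟩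

/-- Every `X q` has degree at least `1`, so a product of degree above `l` exceeds the cutoff `l +
1`. This cutoff still lets `X p` with `deg p ≤ l` act on degree `1`. -/
theorem truncAd_prod_eq_zero {l : ℕ} (ns : List NPlus) (h : l < (ns.map NPlus.deg).sum) :
    (ns.map (truncAd l)).prod = 0 := by
  apply LieAlg.linearMap_ext
  intro q
  obtain ⟨c, p, h1, h2⟩ := truncAd_prod l ns q
  rw [h1, LinearMap.zero_apply]
  by_cases hc : c = 0
  · rw [hc, zero_smul]
  · have h3 := h2 hc
    have h4 := h3.2 (by rintro rfl; simp at h)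
    have := q.deg_pos
    omega

/-- The truncated adjoint representation of `A l`. -/
def adjointRep (l : ℕ) : A l →ₐ[ℚ] Module.End ℚ LieAlg :=
  liftA (truncAd l) (truncAd_commutator l) truncAd_prod_eq_zero

/-- The coefficient of `X n`. -/
def LieAlg.coeff (n : NPlus) : LieAlg →ₗ[ℚ] ℚ := (Finsupp.lapply n : (NPlus →₀ ℚ) →ₗ[ℚ] ℚ)

open Classical in
theorem LieAlg.coeff_X (n m : NPlus) : LieAlg.coeff n (X m) = if m = n then 1 else 0 :=
  Finsupp.single_apply

/-- Applied to `X e` with `e = e₁, e₂`, the truncated adjoint representation detects `c p * {p, e}`.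
The values `{p, e₁} = p.snd` and `{p, e₂} = -p.fst` are not both zero. -/
theorem coeff_eq_zero_of_toA_sum_eq_zero {l : ℕ} {s : Finset NPlus} {c : NPlus → ℚ}
    (h : toA l (∑ p ∈ s, c p • X p) = 0) {p : NPlus} (hp : p ∈ s) (hpl : p.deg ≤ l) :
    c p = 0 := by
  have key : ∀ e : NPlus, e.deg = 1 → c p * NPlus.form p e = 0 := by
    intro e he
    have h1 := congrArg (fun a => LieAlg.coeff (p + e) (adjointRep l a (X e))) h
    simp only [map_sum, map_smul, adjointRep, liftA_X, map_zero, LinearMap.zero_apply,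
      LinearMap.sum_apply, LinearMap.smul_apply, truncAd_X] at h1
    -- Only `q = p` contributes to the coefficient of `X (p + e)`, by cancellation in `q + e = p +
    -- e`.
    rw [Finset.sum_eq_single p] at h1
    · rw [if_pos (by rw [NPlus.deg_add]; omega), map_smul, LieAlg.coeff_X, if_pos rfl] at h1
      simpa using h1
    · intro q _ hq
      split_ifs
      · rw [map_smul, LieAlg.coeff_X, if_neg, smul_zero, smul_zero]
        intro hqe
        apply hq
        have h2 := congrArg NPlus.fst hqe
        have h3 := congrArg NPlus.snd hqe
        simp only [NPlus.add_fst, NPlus.add_snd] at h2 h3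
        ext <;> omega
      · rw [map_zero, smul_zero]
    · exact fun h => (h hp).elim
  have h1 := key NPlus.e₁ rfl
  have h2 := key NPlus.e₂ rfl
  simp only [NPlus.form, NPlus.e₁, NPlus.e₂, Nat.cast_one, Nat.cast_zero, mul_one, mul_zero,
    sub_zero, zero_sub] at h1 h2
  have h3 : (p.fst : ℚ) + p.snd ≠ 0 := by exact_mod_cast p.pos.ne'
  have h4 : c p * ((p.fst : ℚ) + p.snd) = 0 := by linarith
  exact (mul_eq_zero.1 h4).resolve_right h3

/-! ### The degree derivation -/

-- Leibniz rule for products of homogeneous generators; it shows that the relations of `A l` also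
-- hold for the deformed generators used in `degDual`.
open TrivSqZeroExt in
theorem prod_inl_add_inr (l : ℕ) (ns : List NPlus) :
    (ns.map fun n => (inl (toA l (X n)) + inr ((n.deg : ℚ) • toA l (X n)) :
      DualNumber (A l))).prod =
      inl (ns.map fun n => toA l (X n)).prod +
        inr (((ns.map NPlus.deg).sum : ℚ) • (ns.map fun n => toA l (X n)).prod) := by
  induction ns with
  | nil => simp
  | cons n ns ih =>
    rw [List.map_cons, List.prod_cons, ih]
    ext
    · simp
    · simp [add_smul, add_comm]

open TrivSqZeroExt in
/-- The morphism `a ↦ a + ε D a`, where `D` is the derivation with `D (X n) = deg n • X n`. -/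
def degDual (l : ℕ) : A l →ₐ[ℚ] DualNumber (A l) :=
  liftA (fun n => inl (toA l (X n)) + inr ((n.deg : ℚ) • toA l (X n)))
    (fun n m => by
      ext
      · simpa using toA_X_commutator l n m
      · have h := toA_X_commutator l n m
        have h2 : ((n + m).deg : ℚ) = n.deg + m.deg := by rw [NPlus.deg_add]; push_cast; ring
        simp only [snd_sub, snd_mul, fst_add, fst_inl, fst_inr, add_zero, snd_add, snd_inl,
          snd_inr, zero_add, smul_eq_mul, op_smul_eq_mul, snd_smul, mul_smul_comm,
          smul_mul_assoc]
        rw [smul_comm, ← h, h2, add_smul, smul_sub, smul_sub]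
        abel)
    (fun ns h => by
      rw [prod_inl_add_inr, prod_toA_X l ns h]
      simp)

open TrivSqZeroExt in
theorem fst_degDual (l : ℕ) (a : A l) : (degDual l a).fst = a := by
  have h : (fstHom ℚ (A l) (A l)).comp (degDual l) = AlgHom.id ℚ (A l) := hom_ext_A fun n => by
    show (degDual l _).fst = _
    rw [degDual, liftA_X]
    simp
  exact DFunLike.congr_fun h a

open TrivSqZeroExt in
/-- The derivation of `A l` with `X n ↦ deg n • X n`. -/
def degDer (l : ℕ) : A l →ₗ[ℚ] A l where
  toFun a := (degDual l a).snd
  map_add' a b := by rw [map_add, snd_add]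
  map_smul' c a := by rw [map_smul, snd_smul, RingHom.id_apply]

open TrivSqZeroExt in
theorem degDer_X (l : ℕ) (n : NPlus) :
    degDer l (toA l (X n)) = (n.deg : ℚ) • toA l (X n) := by
  show (degDual l _).snd = _
  rw [degDual, liftA_X]
  simp

open TrivSqZeroExt in
theorem degDual_eq (l : ℕ) (a : A l) : degDual l a = inl a + inr (degDer l a) := by
  ext
  · simp [fst_degDual]
  · simp [degDer]

open TrivSqZeroExt in
theorem degDer_mul (l : ℕ) (a b : A l) :
    degDer l (a * b) = degDer l a * b + a * degDer l b := by
  show (degDual l (a * b)).snd = _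
  rw [map_mul, snd_mul, fst_degDual, fst_degDual, add_comm]
  rfl

theorem degDer_one (l : ℕ) : degDer l 1 = 0 := by
  show (degDual l 1).snd = 0
  rw [map_one, TrivSqZeroExt.snd_one]

theorem degDer_prod (l : ℕ) (ns : List NPlus) :
    degDer l (ns.map fun n => toA l (X n)).prod =
      ((ns.map NPlus.deg).sum : ℚ) • (ns.map fun n => toA l (X n)).prod := by
  induction ns with
  | nil => simp [degDer_one]
  | cons n ns ih =>
    rw [List.map_cons, List.prod_cons, degDer_mul, ih, degDer_X]
    simp [add_smul]

-- Over the dual numbers, commutation gives `exp (a + ε D a) = (1 + ε D a) exp a`; the coefficient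
-- of `ε` is the claim.
open TrivSqZeroExt in
theorem degDer_exp {l : ℕ} {a : A l} (ha : IsNilpotent a) (h : Commute a (degDer l a)) :
    degDer l (IsNilpotent.exp a) = degDer l a * IsNilpotent.exp a := by
  have h0 : (inr (degDer l a) : DualNumber (A l)) ^ 2 = 0 := by
    rw [sq, inr_mul_inr]
  have hc : Commute (inl a : DualNumber (A l)) (inr (degDer l a)) := by
    show inl a * inr (degDer l a) = inr (degDer l a) * inl a
    rw [inl_mul_inr, inr_mul_inl, smul_eq_mul, op_smul_eq_mul, h.eq]
  have h1 : degDual l (IsNilpotent.exp a) =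
      inr (degDer l a) * inl (IsNilpotent.exp a) + inl (IsNilpotent.exp a) := by
    have h2 : (inl (IsNilpotent.exp a) : DualNumber (A l)) = IsNilpotent.exp (inl a) :=
      IsNilpotent.map_exp ha (inlHom (A l) (A l))
    have h3 : IsNilpotent (inl a : DualNumber (A l)) := ha.map (inlHom (A l) (A l))
    rw [IsNilpotent.map_exp ha, degDual_eq, add_comm,
      IsNilpotent.exp_add_of_commute hc.symm ⟨2, h0⟩ h3, h2, IsNilpotent.exp_eq_sum h0]
    simp [Finset.sum_range_succ, add_mul, add_comm]
  show (degDual l _).snd = _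
  rw [h1]
  simp

/-! ### Conjugation by exponentials and logarithmic derivatives -/

theorem exp_mulRight {R : Type*} [Ring R] [Algebra ℚ R] {a : R} (ha : IsNilpotent a) (z : R) :
    IsNilpotent.exp (LinearMap.mulRight ℚ a) z = z * IsNilpotent.exp a := by
  obtain ⟨k, hk⟩ := ha
  have h : (LinearMap.mulRight ℚ a) ^ k = 0 := by
    rw [LinearMap.pow_mulRight, hk]; simp
  rw [IsNilpotent.exp_eq_sum hk, IsNilpotent.exp_eq_sum h, LinearMap.sum_apply, Finset.mul_sum]
  refine Finset.sum_congr rfl fun i _ => ?_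
  rw [LinearMap.smul_apply, LinearMap.pow_mulRight, LinearMap.mulRight_apply, mul_smul_comm]

theorem exp_mulLeft {R : Type*} [Ring R] [Algebra ℚ R] {a : R} (ha : IsNilpotent a) (z : R) :
    IsNilpotent.exp (LinearMap.mulLeft ℚ a) z = IsNilpotent.exp a * z := by
  obtain ⟨k, hk⟩ := ha
  have h : (LinearMap.mulLeft ℚ a) ^ k = 0 := by
    rw [LinearMap.pow_mulLeft, hk]; simp
  rw [IsNilpotent.exp_eq_sum hk, IsNilpotent.exp_eq_sum h, LinearMap.sum_apply, Finset.sum_mul]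
  refine Finset.sum_congr rfl fun i _ => ?_
  rw [LinearMap.smul_apply, LinearMap.pow_mulLeft, LinearMap.mulLeft_apply, smul_mul_assoc]

/-- Left and right multiplications commute, so conjugation by `exp a` is the exponential of `z ↦ a z
- z a`, and every power of this operator preserves the image of `𝔤`. -/
theorem exp_conj_mem_range_toA (l : ℕ) (x : LieAlg) {z : A l} (hz : z ∈ LinearMap.range (toA l)) :
    IsNilpotent.exp (toA l x) * z * IsNilpotent.exp (-toA l x) ∈ LinearMap.range (toA l) := by
  set a := toA l x with ha
  have hn : IsNilpotent a := isNilpotent_toA l x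
  have h1 : IsNilpotent (LinearMap.mulLeft ℚ a) := by
    obtain ⟨k, hk⟩ := hn
    exact ⟨k, by rw [LinearMap.pow_mulLeft, hk]; simp⟩
  have h2 : IsNilpotent (LinearMap.mulRight ℚ (-a)) := by
    obtain ⟨k, hk⟩ := hn.neg
    exact ⟨k, by rw [LinearMap.pow_mulRight, hk]; simp⟩
  have hc : Commute (LinearMap.mulLeft ℚ a) (LinearMap.mulRight ℚ (-a)) :=
    LinearMap.commute_mulLeft_right a (-a)
  have h3 : IsNilpotent.exp (LinearMap.mulLeft ℚ a + LinearMap.mulRight ℚ (-a)) z =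
      IsNilpotent.exp a * z * IsNilpotent.exp (-a) := by
    rw [IsNilpotent.exp_add_of_commute hc h1 h2, Module.End.mul_apply, exp_mulRight hn.neg,
      exp_mulLeft hn, mul_assoc]
  rw [← h3, IsNilpotent.exp, LinearMap.sum_apply]
  refine Submodule.sum_mem _ fun i _ => Submodule.smul_mem _ _ ?_
  clear * - hz ha
  induction i with
  | zero => simpa using hz
  | succ i ih =>
    rw [pow_succ', Module.End.mul_apply]
    obtain ⟨w, hw⟩ := ih
    refine ⟨⁅x, w⁆, ?_⟩
    rw [toA_lie, hw, LinearMap.add_apply, LinearMap.mulLeft_apply, LinearMap.mulRight_apply,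
      mul_neg, sub_eq_add_neg]

theorem degDer_toA (l : ℕ) (x : LieAlg) : degDer l (toA l x) ∈ LinearMap.range (toA l) := by
  induction x using LieAlg.induction with
  | zero => simp
  | add a b ha hb => rw [map_add, map_add]; exact Submodule.add_mem _ ha hb
  | smul c n =>
    rw [map_smul, map_smul, degDer_X, ← map_smul, ← map_smul]
    exact ⟨_, rfl⟩

/-- The units `g` of `A l` normalizing `𝔤^{≤ l}` whose logarithmic derivative with respect to the
degree derivation lies in `𝔤^{≤ l}`. -/
def logDerSubgroup (l : ℕ) : Subgroup (A l)ˣ where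
  carrier := {g | degDer l g * ↑g⁻¹ ∈ LinearMap.range (toA l) ∧
    ∀ z ∈ LinearMap.range (toA l), ↑g * z * ↑g⁻¹ ∈ LinearMap.range (toA l) ∧
      ↑g⁻¹ * z * ↑g ∈ LinearMap.range (toA l)}
  one_mem' := ⟨by simp [degDer_one], fun z hz => by simpa using hz⟩
  mul_mem' := by
    rintro g h ⟨hg1, hg2⟩ ⟨hh1, hh2⟩
    refine ⟨?_, fun z hz => ⟨?_, ?_⟩⟩
    · have e : degDer l ↑(g * h) * ↑(g * h)⁻¹ =
          degDer l g * ↑g⁻¹ + ↑g * (degDer l h * ↑h⁻¹) * ↑g⁻¹ := by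
        rw [mul_inv_rev, Units.val_mul, Units.val_mul, degDer_mul, add_mul]
        congr 1
        · rw [mul_assoc, Units.mul_inv_cancel_left]
        · simp only [mul_assoc]
      rw [e]
      exact Submodule.add_mem _ hg1 (hg2 _ hh1).1
    · have := (hg2 _ (hh2 z hz).1).1
      simpa only [mul_inv_rev, Units.val_mul, mul_assoc] using this
    · have := (hh2 _ (hg2 z hz).2).2
      simpa only [mul_inv_rev, Units.val_mul, mul_assoc] using this
  inv_mem' := by
    rintro g ⟨hg1, hg2⟩
    refine ⟨?_, fun z hz => by rw [inv_inv]; exact (hg2 z hz).symm⟩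
    -- Differentiating `g⁻¹ g = 1` gives `D(g⁻¹) g = -g⁻¹ D g`, the conjugate by `g⁻¹` of `-(D g *
    -- g⁻¹)`.
    have h1 := degDer_mul l ↑g⁻¹ (g : A l)
    rw [Units.inv_mul, degDer_one] at h1
    rw [inv_inv, eq_neg_of_add_eq_zero_left h1.symm]
    refine Submodule.neg_mem _ ?_
    have h2 := (hg2 _ hg1).2
    simpa only [mul_assoc, Units.inv_mul, mul_one] using h2

theorem expLE_mem_logDerSubgroup {l : ℕ} {x : LieAlg}
    (h : Commute (toA l x) (degDer l (toA l x))) : expLE l x ∈ logDerSubgroup l := by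
  refine ⟨?_, fun z hz => ⟨exp_conj_mem_range_toA l x hz, ?_⟩⟩
  · show degDer l (IsNilpotent.exp (toA l x)) * IsNilpotent.exp (-toA l x) ∈ _
    rw [degDer_exp (isNilpotent_toA l x) h, mul_assoc,
      IsNilpotent.exp_mul_exp_neg_self (isNilpotent_toA l x), mul_one]
    exact degDer_toA l x
  · have := exp_conj_mem_range_toA l (-x) hz
    rwa [map_neg, neg_neg] at this

/-! ### The kernel of `A (l + 1) → A l` -/

/-- The elements of `A l` that have degree `d` and are annihilated by all `X n`. -/
def topPart (l d : ℕ) : Submodule ℚ (A l) where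
  carrier := {y | degDer l y = (d : ℚ) • y ∧ ∀ n, y * toA l (X n) = 0 ∧ toA l (X n) * y = 0}
  zero_mem' := by simp
  add_mem' := by
    rintro a b ⟨ha, ha'⟩ ⟨hb, hb'⟩
    exact ⟨by rw [map_add, ha, hb, smul_add], fun n => ⟨by
      rw [add_mul, (ha' n).1, (hb' n).1, add_zero], by
      rw [mul_add, (ha' n).2, (hb' n).2, add_zero]⟩⟩
  smul_mem' := by
    rintro c a ⟨ha, ha'⟩
    exact ⟨by rw [map_smul, ha, smul_comm], fun n => ⟨by
      rw [smul_mul_assoc, (ha' n).1, smul_zero], by rw [mul_smul_comm, (ha' n).2, smul_zero]⟩⟩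

/-- The congruence defined by the two-sided ideal `topPart l d`. -/
def topCon (l d : ℕ) : RingCon (A l) where
  r a b := a - b ∈ topPart l d
  iseqv := ⟨fun a => by rw [sub_self]; exact zero_mem _,
    fun {a b} h => by rw [← neg_sub]; exact neg_mem h,
    fun {a b c} h h' => by rw [← sub_add_sub_cancel a b c]; exact add_mem h h'⟩
  add' := fun {a b c d'} h h' => by rw [add_sub_add_comm]; exact add_mem h h'
  mul' := fun {a b c d'} h h' => by
    have e : a * c - b * d' = (a - b) * c + b * (c - d') := by noncomm_ring
    rw [e]
    refine add_mem (mul_mem_of_mul_X_mem _ (fun y hy n => ?_) h _)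
      (mul_mem_of_X_mul_mem _ (fun y hy n => ?_) h' _)
    · rw [(hy.2 n).1]; exact zero_mem _
    · rw [(hy.2 n).2]; exact zero_mem _

theorem prod_mem_topPart {l : ℕ} (ns : List NPlus) (h : l < (ns.map NPlus.deg).sum) :
    (ns.map fun n => toA (l + 1) (X n)).prod ∈ topPart (l + 1) (l + 1) := by
  by_cases h1 : (ns.map NPlus.deg).sum = l + 1
  · refine ⟨by rw [degDer_prod, ← h1], fun n => ?_⟩
    have := n.deg_pos
    have h2 := prod_toA_X (l + 1) (ns ++ [n]) (by simp; omega)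
    have h3 := prod_toA_X (l + 1) (n :: ns) (by simp; omega)
    simpa using And.intro h2 h3
  · rw [prod_toA_X (l + 1) ns (by omega)]
    exact zero_mem _

/-- Products of degree above `l` lie in the ideal `topPart`, so the quotient by it satisfies the
relations of `A l`. The quotient map therefore factors through `A l` and kills `y`. -/
theorem mem_topPart_of_transA_eq_zero {l : ℕ} {y : A (l + 1)} (h : transA (Nat.le_succ l) y = 0) :
    y ∈ topPart (l + 1) (l + 1) := by
  let q : A (l + 1) →ₐ[ℚ] (topCon (l + 1) (l + 1)).Quotient := RingCon.mkₐ ℚ _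
  have hq : ∀ a, q a = 0 → a ∈ topPart (l + 1) (l + 1) := fun a ha => by
    have : a - 0 ∈ topPart (l + 1) (l + 1) := (RingCon.eq _).1 ha
    rwa [sub_zero] at this
  have hq' : ∀ a ∈ topPart (l + 1) (l + 1), q a = 0 := fun a ha =>
    (RingCon.eq _).2 (show a - 0 ∈ _ by rwa [sub_zero])
  let s : A l →ₐ[ℚ] (topCon (l + 1) (l + 1)).Quotient := liftA (fun n => q (toA (l + 1) (X n)))
    (fun n m => by rw [← map_mul q, ← map_mul q, ← map_sub, toA_X_commutator, map_smul])
    (fun ns hns => by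
      have := hq' _ (prod_mem_topPart ns hns)
      rwa [map_list_prod, List.map_map] at this)
  have hs : s.comp (transA (Nat.le_succ l)) = q := hom_ext_A fun n => by
    rw [AlgHom.comp_apply, transA_toA]
    exact liftA_X _ _ _ n
  apply hq
  rw [← hs, AlgHom.comp_apply, h, map_zero]

/-! ### Units acting trivially on the top degree -/

theorem exp_mul_of_mul_eq_zero {R : Type*} [Ring R] [Algebra ℚ R] {a y : R} (ha : IsNilpotent a)
    (h : a * y = 0) : IsNilpotent.exp a * y = y := by
  have := IsNilpotent.exp_smul_eq_sum (a := a) (m := y) (k := 1) (by simpa using h) ha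
  simpa using this

theorem mul_exp_of_mul_eq_zero {R : Type*} [Ring R] [Algebra ℚ R] {a y : R} (ha : IsNilpotent a)
    (h : y * a = 0) : y * IsNilpotent.exp a = y := by
  have hn : IsNilpotent (LinearMap.mulRight ℚ a) := by
    obtain ⟨k, hk⟩ := ha
    exact ⟨k, by rw [LinearMap.pow_mulRight, hk]; simp⟩
  have := IsNilpotent.exp_smul_eq_sum (a := LinearMap.mulRight ℚ a) (m := y) (k := 1)
    (by simpa using h) hn
  rw [← exp_mulRight ha]
  simpa using this

theorem mul_toA_eq_zero_of_mem_topPart {l d : ℕ} {y : A l} (hy : y ∈ topPart l d) (x : LieAlg) :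
    y * toA l x = 0 ∧ toA l x * y = 0 := by
  induction x using LieAlg.induction with
  | zero => simp
  | add a b ha hb => simp [mul_add, add_mul, ha, hb]
  | smul c n => simp [hy.2 n]

/-- The units of `A l` acting trivially on the elements of degree `l`. -/
def topStabilizer (l : ℕ) : Subgroup (A l)ˣ where
  carrier := {g | ∀ y ∈ topPart l l, y * g = y ∧ ↑g * y = y}
  one_mem' := fun y _ => by simp
  mul_mem' := fun {g h} hg hh y hy => by
    rw [Units.val_mul, ← mul_assoc, (hg y hy).1, (hh y hy).1, mul_assoc, (hh y hy).2, (hg y hy).2]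
    exact ⟨rfl, rfl⟩
  inv_mem' := fun {g} hg y hy =>
    ⟨by rw [Units.mul_inv_eq_iff_eq_mul, (hg y hy).1],
      by rw [Units.inv_mul_eq_iff_eq_mul, (hg y hy).2]⟩

/-- Since `𝔤` annihilates the top part, only the constant term `1` of an exponential acts on it.
Top-degree corrections can thus be moved past any group element. -/
theorem GLE_le_topStabilizer (l : ℕ) : GLE l ≤ topStabilizer l := by
  rw [GLE, Subgroup.closure_le]
  rintro _ ⟨x, rfl⟩ y hy
  have h := mul_toA_eq_zero_of_mem_topPart hy x
  exact ⟨mul_exp_of_mul_eq_zero (isNilpotent_toA l x) h.1,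
    exp_mul_of_mul_eq_zero (isNilpotent_toA l x) h.2⟩

theorem toA_X_mem_topPart {l : ℕ} {p : NPlus} (h : l < p.deg) :
    toA (l + 1) (X p) ∈ topPart (l + 1) (l + 1) := by
  simpa using prod_mem_topPart [p] (by simpa using h)

theorem toA_eq_toA_trunc (l : ℕ) (x : LieAlg) :
    toA l x = toA l (trunc l fun n => LieAlg.coeff n x) := by
  induction x using LieAlg.induction with
  | zero => simp [trunc]
  | add a b ha hb =>
    rw [map_add, ha, hb, ← map_add]
    simp only [trunc, map_add, add_smul, Finset.sum_add_distrib]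
  | smul c n =>
    by_cases h : n.deg ≤ l
    · rw [trunc, Finset.sum_eq_single n]
      · simp [LieAlg.coeff_X]
      · intro m _ hm
        simp [LieAlg.coeff_X, hm.symm]
      · simp [h]
    · rw [map_smul, toA_X_eq_zero (by omega), smul_zero, trunc, Finset.sum_eq_zero, map_zero]
      intro m hm
      have : n ≠ m := by
        rintro rfl
        exact h (NPlus.mem_degLE.1 hm)
      simp [LieAlg.coeff_X, this]

theorem GLE_zero : GLE 0 = ⊥ := by
  rw [eq_bot_iff, GLE, Subgroup.closure_le]
  rintro _ ⟨x, rfl⟩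
  rw [SetLike.mem_coe, Subgroup.mem_bot]
  apply Units.ext
  show IsNilpotent.exp (toA 0 x) = 1
  have h : toA 0 x = 0 := by
    rw [toA_eq_toA_trunc, trunc, Finset.sum_eq_zero, map_zero]
    intro n hn
    have := n.deg_pos
    have := NPlus.mem_degLE.1 hn
    omega
  rw [h, IsNilpotent.exp_zero]

/-- A unit in `A (l + 1)` of the group `logDerSubgroup` with trivial image in `A l` is
`1 + ∑ c_p X_p` with a sum over degree `l + 1`. -/
theorem exists_eq_one_add_toA_trunc {l : ℕ} {h : (A (l + 1))ˣ} (h1 : h ∈ logDerSubgroup (l + 1))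
    (h2 : h ∈ GLE (l + 1)) (h3 : transA (Nat.le_succ l) (h : A (l + 1)) = 1) :
    ∃ c : NPlus → ℚ, (∀ p, p.deg ≤ l → c p = 0) ∧
      (h : A (l + 1)) = 1 + toA (l + 1) (trunc (l + 1) c) := by
  have hy : (h : A (l + 1)) - 1 ∈ topPart (l + 1) (l + 1) :=
    mem_topPart_of_transA_eq_zero (by rw [map_sub, h3, map_one, sub_self])
  -- `D h = D (h - 1) = (l + 1) (h - 1)`, and `h⁻¹` fixes the top-degree element `h - 1`. Dividing
  -- by `l + 1` puts `h - 1` in `𝔤`.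
  have hD : degDer (l + 1) (h : A (l + 1)) * ↑h⁻¹ = ((l + 1 : ℕ) : ℚ) • ((h : A (l + 1)) - 1) := by
    have e := hy.1
    rw [map_sub, degDer_one, sub_zero] at e
    rw [e, smul_mul_assoc, ((GLE_le_topStabilizer (l + 1)) (inv_mem h2) _ hy).1]
  have hL : (h : A (l + 1)) - 1 ∈ LinearMap.range (toA (l + 1)) := by
    have := h1.1
    rw [hD] at this
    exact (Submodule.smul_mem_iff _ (by positivity)).1 this
  obtain ⟨x, hx⟩ := hL
  refine ⟨fun n => LieAlg.coeff n x, fun p hp => ?_, ?_⟩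
  · have h0 : toA l (trunc l fun n => LieAlg.coeff n x) = 0 := by
      rw [← toA_eq_toA_trunc, ← transA_toA (Nat.le_succ l), hx, map_sub, h3, map_one, sub_self]
    exact coeff_eq_zero_of_toA_sum_eq_zero h0 (NPlus.mem_degLE.2 hp) hp
  · rw [← toA_eq_toA_trunc, hx, add_sub_cancel]

/-! ### Dilogarithm elements -/

theorem exists_of_dilogSeries_ne_zero {n p : NPlus} (h : dilogSeries n p ≠ 0) :
    ∃ j : ℕ, p.fst = j * n.fst ∧ p.snd = j * n.snd := by
  by_contra hj
  exact h (dif_neg hj)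

theorem dilogSeries_self (n : NPlus) : dilogSeries n n = 1 := by
  have h : ∃ j : ℕ, n.fst = j * n.fst ∧ n.snd = j * n.snd := ⟨1, by simp⟩
  rw [dilogSeries, dif_pos h]
  have h1 : h.choose = 1 := by
    obtain ⟨h2, h3⟩ := h.choose_spec
    have hn := n.pos
    have h4 : h.choose * (n.fst + n.snd) = 1 * (n.fst + n.snd) := by rw [mul_add]; omega
    exact Nat.eq_of_mul_eq_mul_right hn h4
  rw [h1]
  norm_num

theorem dilogSeries_eq_zero {n p : NPlus} (h : p.deg ≤ n.deg) (hp : p ≠ n) :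
    dilogSeries n p = 0 := by
  by_contra h0
  obtain ⟨j, h1, h2⟩ := exists_of_dilogSeries_ne_zero h0
  have hpp := p.pos
  have hn := n.pos
  have hd : p.deg = j * n.deg := by rw [NPlus.deg, NPlus.deg, h1, h2, mul_add]
  have hj0 : j ≠ 0 := by rintro rfl; simp only [NPlus.deg] at hd; omega
  have hj1 : j ≤ 1 := by
    rw [hd] at h
    exact Nat.le_of_mul_le_mul_right (by simpa using h) n.deg_pos
  obtain rfl : j = 1 := by omega
  exact hp (NPlus.ext (by simpa using h1) (by simpa using h2))

theorem toA_X_commute {l : ℕ} {n m : NPlus} (h : NPlus.form n m = 0) :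
    Commute (toA l (X n)) (toA l (X m)) := by
  have := toA_X_commutator l n m
  rw [h, zero_smul] at this
  exact sub_eq_zero.1 this

theorem toA_trunc_commute {l : ℕ} {c d : NPlus → ℚ}
    (h : ∀ n m, c n ≠ 0 → d m ≠ 0 → NPlus.form n m = 0) :
    Commute (toA l (trunc l c)) (toA l (trunc l d)) := by
  rw [trunc, trunc, map_sum, map_sum]
  refine Commute.sum_left _ _ _ fun n _ => Commute.sum_right _ _ _ fun m _ => ?_
  rw [map_smul, map_smul]
  by_cases hc : c n = 0
  · rw [hc, zero_smul]; exact Commute.zero_left _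
  by_cases hd : d m = 0
  · rw [hd, zero_smul]; exact Commute.zero_right _
  exact ((toA_X_commute (h n m hc hd)).smul_left _).smul_right _

theorem degDer_toA_trunc (l : ℕ) (c : NPlus → ℚ) :
    degDer l (toA l (trunc l c)) = toA l (trunc l fun n => c n * n.deg) := by
  simp only [trunc, map_sum, map_smul, degDer_X, smul_smul]

theorem form_eq_zero_of_dilogSeries_ne_zero {p q n m : NPlus} (h : NPlus.form p q = 0)
    (hn : dilogSeries p n ≠ 0) (hm : dilogSeries q m ≠ 0) : NPlus.form n m = 0 := by
  obtain ⟨j, h1, h2⟩ := exists_of_dilogSeries_ne_zero hn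
  obtain ⟨k, h3, h4⟩ := exists_of_dilogSeries_ne_zero hm
  unfold NPlus.form at *
  rw [h1, h2, h3, h4]
  push_cast
  linear_combination (j : ℚ) * k * h

theorem form_self (p : NPlus) : NPlus.form p p = 0 := by
  unfold NPlus.form; ring

/-- The image of `Ψ[p]^c` in the units of `A l`. -/
def dilogUnit (l : ℕ) (p : NPlus) (c : ℚ) : (A l)ˣ := (proj l (dilogPow p c) : GLE l)

theorem dilogUnit_val (l : ℕ) (p : NPlus) (c : ℚ) : (dilogUnit l p c : A l) =
    IsNilpotent.exp (toA l (trunc l fun q => c * dilogSeries p q)) := rfl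

theorem dilogUnit_mem_GLE (l : ℕ) (p : NPlus) (c : ℚ) : dilogUnit l p c ∈ GLE l :=
  (proj l (dilogPow p c)).2

/-- The exponent and its degree derivative are both supported on the ray of `p`, where the form
vanishes, so they commute. -/
theorem dilogUnit_mem_logDerSubgroup (l : ℕ) (p : NPlus) (c : ℚ) :
    dilogUnit l p c ∈ logDerSubgroup l := by
  apply expLE_mem_logDerSubgroup
  rw [degDer_toA_trunc]
  exact toA_trunc_commute fun n m hn hm => form_eq_zero_of_dilogSeries_ne_zero (form_self p)
    (right_ne_zero_of_mul hn) (right_ne_zero_of_mul (left_ne_zero_of_mul hm))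

theorem map_transA_dilogUnit {l l' : ℕ} (h : l ≤ l') (p : NPlus) (c : ℚ) :
    Units.map (transA h : A l' →* A l) (dilogUnit l' p c) = dilogUnit l p c :=
  (dilogPow p c).2.2 l l' h

/-- Only `j = 1` can survive in the exponent, and its square vanishes because `2 deg p > l`. -/
theorem dilogUnit_val_of_le {l : ℕ} {p : NPlus} (h : l ≤ p.deg) (c : ℚ) :
    (dilogUnit l p c : A l) = 1 + c • toA l (X p) := by
  have h1 : toA l (trunc l fun q => c * dilogSeries p q) = c • toA l (X p) := by
    by_cases hl : p.deg ≤ l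
    · rw [trunc, Finset.sum_eq_single p]
      · rw [dilogSeries_self, mul_one, map_smul]
      · intro q hq hqp
        rw [dilogSeries_eq_zero ((NPlus.mem_degLE.1 hq).trans h) hqp, mul_zero, zero_smul]
      · intro hp
        exact (hp (NPlus.mem_degLE.2 hl)).elim
    · rw [toA_X_eq_zero (by omega), smul_zero, trunc, Finset.sum_eq_zero, map_zero]
      intro q hq
      have := NPlus.mem_degLE.1 hq
      rw [dilogSeries_eq_zero (by omega) (by rintro rfl; exact hl this), mul_zero, zero_smul]
  have h2 : (c • toA l (X p)) ^ 2 = 0 := by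
    have hp := p.deg_pos
    have := prod_toA_X l [p, p] (by simp; omega)
    rw [smul_pow, sq (toA l (X p))]
    simp only [List.map_cons, List.map_nil, List.prod_cons, List.prod_nil, mul_one] at this
    rw [this, smul_zero]
  rw [dilogUnit_val, h1, IsNilpotent.exp_eq_sum h2]
  simp [Finset.sum_range_succ]

theorem dilogUnit_commute {l : ℕ} {p q : NPlus} (h : NPlus.form p q = 0) (c d : ℚ) :
    Commute (dilogUnit l p c : A l) (dilogUnit l q d) := by
  have hc : Commute (toA l (trunc l fun n => c * dilogSeries p n))
      (toA l (trunc l fun n => d * dilogSeries q n)) :=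
    toA_trunc_commute fun n m hn hm => form_eq_zero_of_dilogSeries_ne_zero h
      (right_ne_zero_of_mul hn) (right_ne_zero_of_mul hm)
  rw [dilogUnit_val, dilogUnit_val, IsNilpotent.exp, IsNilpotent.exp]
  exact Commute.sum_left _ _ _ fun i _ => Commute.sum_right _ _ _ fun j _ =>
    ((hc.pow_pow i j).smul_left _).smul_right _

/-! ### Ordered products -/

/-- The image in `A k` of the ordered product of the factors of degree at most `l`. -/
def ordProd (k l : ℕ) (u : NPlus → ℚ) : (A k)ˣ :=
  (((NPlus.degLE l).sort (· ≤ ·)).map fun p => dilogUnit k p (u p)).prod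

theorem isOrderedProduct_iff {g : G} {u : NPlus → ℚ} :
    IsOrderedProduct g u ↔ ∀ l, g.1 l = ordProd l l u := by
  refine forall_congr' fun l => ?_
  rw [← (GLE l).subtype_injective.eq_iff, map_list_prod, List.map_map]
  rfl

theorem ordProd_congr {k l : ℕ} {u v : NPlus → ℚ} (h : ∀ p : NPlus, p.deg ≤ l → u p = v p) :
    ordProd k l u = ordProd k l v := by
  unfold ordProd
  congr 1
  refine List.map_congr_left fun p hp => ?_
  rw [h p (NPlus.mem_degLE.1 ((Finset.mem_sort _).1 hp))]

theorem map_transA_ordProd {k k' : ℕ} (h : k ≤ k') (l : ℕ) (u : NPlus → ℚ) :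
    Units.map (transA h : A k' →* A k) (ordProd k' l u) = ordProd k l u := by
  rw [ordProd, map_list_prod, List.map_map, ordProd]
  congr 1
  exact List.map_congr_left fun p _ => map_transA_dilogUnit h p _

theorem ordProd_mem {k l : ℕ} {u : NPlus → ℚ} (S : Subgroup (A k)ˣ)
    (h : ∀ p c, dilogUnit k p c ∈ S) : ordProd k l u ∈ S := by
  refine list_prod_mem fun x hx => ?_
  obtain ⟨p, -, rfl⟩ := List.mem_map.1 hx
  exact h _ _

theorem filter_sort_degLE (l : ℕ) :
    ((NPlus.degLE (l + 1)).sort (· ≤ ·)).filter (fun p => p.deg ≤ l) =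
      (NPlus.degLE l).sort (· ≤ ·) := by
  refine List.Perm.eq_of_pairwise (le := (· ≤ ·)) (fun a b _ _ => le_antisymm)
    ((Finset.pairwise_sort _ _).filter _) (Finset.pairwise_sort _ _) ?_
  rw [List.perm_ext_iff_of_nodup ((Finset.sort_nodup _ _).filter _) (Finset.sort_nodup _ _)]
  intro p
  simp only [List.mem_filter, Finset.mem_sort, NPlus.mem_degLE, decide_eq_true_eq]
  omega

/-- A factor of degree above `l` is `1 + u_p X_p`; its second term is fixed by all other factors, so
it splits off additively wherever it stands. -/
theorem prod_dilogUnit_eq_add (l : ℕ) (u : NPlus → ℚ) (L : List NPlus) :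
    ((L.map fun p => dilogUnit (l + 1) p (u p)).prod : A (l + 1)) =
      (((L.filter fun p => p.deg ≤ l).map fun p => dilogUnit (l + 1) p (u p)).prod : (A (l + 1))ˣ) +
      (L.map fun p => (if p.deg ≤ l then 0 else u p) • toA (l + 1) (X p)).sum := by
  have hstab : ∀ p c, dilogUnit (l + 1) p c ∈ topStabilizer (l + 1) := fun p c =>
    GLE_le_topStabilizer _ (dilogUnit_mem_GLE _ p c)
  induction L with
  | nil => simp
  | cons p L ih =>
    by_cases hp : p.deg ≤ l
    · have hS : (L.map fun p => (if p.deg ≤ l then 0 else u p) • toA (l + 1) (X p)).sum ∈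
          topPart (l + 1) (l + 1) := by
        refine list_sum_mem fun x hx => ?_
        obtain ⟨q, -, rfl⟩ := List.mem_map.1 hx
        split_ifs with hq
        · rw [zero_smul]; exact zero_mem _
        · exact Submodule.smul_mem _ _ (toA_X_mem_topPart (by omega))
      rw [List.filter_cons_of_pos (by simpa using hp)]
      simp only [List.map_cons, List.prod_cons, List.sum_cons, Units.val_mul, ih, mul_add, if_pos hp,
        zero_smul, zero_add, (hstab p (u p) _ hS).2]
    · have hQ : (L.map fun p => dilogUnit (l + 1) p (u p)).prod ∈ topStabilizer (l + 1) := by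
        refine list_prod_mem fun x hx => ?_
        obtain ⟨p, -, rfl⟩ := List.mem_map.1 hx
        exact hstab _ _
      rw [List.filter_cons_of_neg (by simpa using hp)]
      simp only [List.map_cons, List.prod_cons, List.sum_cons, if_neg hp]
      rw [Units.val_mul, dilogUnit_val_of_le (by omega), add_mul, one_mul, smul_mul_assoc,
        (hQ _ (toA_X_mem_topPart (by omega))).1, ih]
      abel

theorem ordProd_succ (l : ℕ) (u : NPlus → ℚ) :
    (ordProd (l + 1) (l + 1) u : A (l + 1)) = ordProd (l + 1) l u +
      toA (l + 1) (trunc (l + 1) fun p => if p.deg ≤ l then 0 else u p) := by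
  rw [ordProd, prod_dilogUnit_eq_add, filter_sort_degLE, ordProd, trunc, map_sum]
  congr 1
  simp only [map_smul]
  rw [← Finset.sum_map_toList]
  exact (((Finset.sort_perm_toList _ _).map _).sum_eq)

/-! ### Uniqueness and existence of the exponents -/

theorem eq_of_ordProd_eq {g : G} {u v : NPlus → ℚ} {l : ℕ} (hu : ∀ k ≤ l, g.1 k = ordProd k k u)
    (hv : ∀ k ≤ l, g.1 k = ordProd k k v) : ∀ p : NPlus, p.deg ≤ l → u p = v p := by
  induction l with
  | zero =>
    intro p hp
    have := p.deg_pos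
    omega
  | succ l ih =>
    have ih' := ih (fun k hk => hu k (hk.trans (Nat.le_succ l)))
      (fun k hk => hv k (hk.trans (Nat.le_succ l)))
    intro p hp
    by_cases hpl : p.deg ≤ l
    · exact ih' p hpl
    have h1 : (ordProd (l + 1) (l + 1) u : A (l + 1)) = ordProd (l + 1) (l + 1) v := by
      rw [← hu _ le_rfl, ← hv _ le_rfl]
    rw [ordProd_succ, ordProd_succ, ordProd_congr ih'] at h1
    have h2 := sub_eq_zero.2 (add_left_cancel h1)
    rw [← map_sub, trunc, trunc, ← Finset.sum_sub_distrib] at h2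
    simp only [← sub_smul] at h2
    have h3 := coeff_eq_zero_of_toA_sum_eq_zero h2 (NPlus.mem_degLE.2 hp) hp
    rw [if_neg hpl, if_neg hpl] at h3
    exact sub_eq_zero.1 h3

theorem exists_ordProd_eq {g : G} (hg : ∀ l, g.1 l ∈ logDerSubgroup l) (l : ℕ) :
    ∃ u : NPlus → ℚ, ∀ k ≤ l, g.1 k = ordProd k k u := by
  induction l with
  | zero =>
    refine ⟨0, fun k hk => ?_⟩
    obtain rfl : k = 0 := by omega
    have h1 : g.1 0 ∈ GLE 0 := g.2.1 0
    have h2 : ordProd 0 0 0 ∈ GLE 0 := ordProd_mem _ fun p c => dilogUnit_mem_GLE 0 p c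
    rw [GLE_zero, Subgroup.mem_bot] at h1 h2
    rw [h1, h2]
  | succ l ih =>
    obtain ⟨u, hu⟩ := ih
    set P := ordProd (l + 1) l u with hP
    have hPt : Units.map (transA (Nat.le_succ l) : A (l + 1) →* A l) (g.1 (l + 1) * P⁻¹) = 1 := by
      rw [map_mul, map_inv, hP, map_transA_ordProd, g.2.2 l (l + 1) (Nat.le_succ l), hu l le_rfl,
        mul_inv_cancel]
    obtain ⟨c, hc0, hc⟩ := exists_eq_one_add_toA_trunc (h := g.1 (l + 1) * P⁻¹)
      (mul_mem (hg _) (inv_mem (ordProd_mem _ fun p c => dilogUnit_mem_logDerSubgroup _ p c)))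
      (mul_mem (g.2.1 _) (inv_mem (ordProd_mem _ fun p c => dilogUnit_mem_GLE _ p c)))
      (congrArg Units.val hPt)
    have hcP : toA (l + 1) (trunc (l + 1) c) * (P : A (l + 1)) = toA (l + 1) (trunc (l + 1) c) := by
      have hmem : toA (l + 1) (trunc (l + 1) c) ∈ topPart (l + 1) (l + 1) := by
        rw [trunc, map_sum]
        refine Submodule.sum_mem _ fun p _ => ?_
        rw [map_smul]
        by_cases hp : p.deg ≤ l
        · rw [hc0 p hp, zero_smul]; exact zero_mem _
        · exact Submodule.smul_mem _ _ (toA_X_mem_topPart (by omega))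
      exact (GLE_le_topStabilizer _ (ordProd_mem _ fun p c => dilogUnit_mem_GLE _ p c) _ hmem).1
    -- The coefficients of `g P⁻¹ = 1 + ∑ c_p X_p` serve as the new exponents: multiplying by `P`
    -- leaves the sum unchanged.
    let w : NPlus → ℚ := fun p => if p.deg ≤ l then u p else c p
    have hw : ∀ p : NPlus, p.deg ≤ l → w p = u p := fun p hp => if_pos hp
    refine ⟨w, fun k hk => ?_⟩
    by_cases hkl : k ≤ l
    · rw [hu k hkl]
      exact ordProd_congr fun p hp => (hw p (hp.trans hkl)).symm
    obtain rfl : k = l + 1 := by omega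
    apply Units.ext
    have hwc : (fun p => if p.deg ≤ l then 0 else w p) = c := by
      funext p
      by_cases hp : p.deg ≤ l
      · rw [if_pos hp, hc0 p hp]
      · rw [if_neg hp]; exact if_neg hp
    rw [ordProd_succ, hwc, ordProd_congr hw, ← hP, ← hcP]
    rw [Units.val_mul] at hc
    have h5 := congrArg (· * (P : A (l + 1))) hc
    simp only [Units.inv_mul_cancel_right, add_mul, one_mul] at h5
    exact h5

theorem existsUnique_isOrderedProduct {g : G} (hg : ∀ l, g.1 l ∈ logDerSubgroup l) :
    ∃! u : NPlus → ℚ, IsOrderedProduct g u := by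
  choose v hv using exists_ordProd_eq hg
  -- The families chosen for different `l` need not agree in high degrees, but by uniqueness they
  -- agree wherever they matter; the diagonal glues them.
  refine ⟨fun p => v p.deg p, ?_, fun w hw => ?_⟩
  · refine isOrderedProduct_iff.2 fun l => ?_
    rw [hv l l le_rfl]
    exact ordProd_congr fun p hp =>
      eq_of_ordProd_eq (fun k hk => hv l k (hk.trans hp)) (hv p.deg) p le_rfl
  · replace hw := isOrderedProduct_iff.1 hw
    funext p
    exact eq_of_ordProd_eq (fun k _ => hw k) (hv p.deg) p le_rfl

theorem antiOrdered_mem_logDerSubgroup (m n l : ℕ) :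
    (antiOrdered m n).1 l ∈ logDerSubgroup l :=
  mul_mem (dilogUnit_mem_logDerSubgroup l NPlus.e₂ n) (dilogUnit_mem_logDerSubgroup l NPlus.e₁ m)

/-! ### The anti-involution `X n ↦ X (swap n)` -/

theorem swap_swap (p : NPlus) : p.swap.swap = p := rfl

theorem deg_swap (p : NPlus) : p.swap.deg = p.deg := Nat.add_comm _ _

theorem swap_add (p q : NPlus) : (p + q).swap = p.swap + q.swap := rfl

theorem nplus_add_comm (p q : NPlus) : p + q = q + p := by
  ext <;> simp [add_comm]

theorem form_swap (p q : NPlus) : NPlus.form p.swap q.swap = -NPlus.form p q := by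
  simp only [NPlus.form, NPlus.swap]; ring

theorem form_skew (p q : NPlus) : NPlus.form p q = -NPlus.form q p := by
  simp only [NPlus.form]; ring

open MulOpposite in
/-- The anti-involution of `A l` with `X n ↦ X (swap n)`. -/
def swapHom (l : ℕ) : A l →ₐ[ℚ] (A l)ᵐᵒᵖ :=
  liftA (fun n => op (toA l (X n.swap)))
    (fun n m => by
      -- Two signs cancel: the opposite ring reverses the commutator, and swapping negates the form.
      rw [← op_mul, ← op_mul, ← op_sub, toA_X_commutator, form_swap, ← form_skew, op_smul,
        swap_add, nplus_add_comm])
    (fun ns h => by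
      have h1 := prod_toA_X l (ns.map NPlus.swap).reverse (by
        simpa [List.sum_reverse, Function.comp_def, deg_swap] using h)
      apply unop_injective
      rw [unop_list_prod, unop_zero, ← h1]
      simp [Function.comp_def])

open Classical in
theorem dilogSeries_swap (n p : NPlus) : dilogSeries n.swap p.swap = dilogSeries n p := by
  -- The two chosen witnesses belong to predicates that differ by the order of a conjunction, so the
  -- predicates themselves have to be identified.
  have key : ∀ P Q : ℕ → Prop, P = Q →
      (if h : ∃ j, P j then (-1) ^ (h.choose + 1) / (h.choose : ℚ) ^ 2 else 0) =
        if h : ∃ j, Q j then (-1) ^ (h.choose + 1) / (h.choose : ℚ) ^ 2 else 0 := by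
    rintro P _ rfl
    rfl
  exact key _ _ (funext fun j => propext and_comm)

open MulOpposite in
theorem exp_op {R : Type*} [Ring R] [Algebra ℚ R] {a : R} (ha : IsNilpotent a) :
    IsNilpotent.exp (op a) = op (IsNilpotent.exp a) := by
  obtain ⟨k, hk⟩ := ha
  have h : (op a) ^ k = 0 := by rw [← op_pow, hk, op_zero]
  rw [IsNilpotent.exp_eq_sum hk, IsNilpotent.exp_eq_sum h, Finset.op_sum]
  simp only [op_smul, op_pow]

open MulOpposite in
theorem swapHom_dilogUnit (l : ℕ) (p : NPlus) (c : ℚ) :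
    swapHom l (dilogUnit l p c) = op (dilogUnit l p.swap c : A l) := by
  rw [dilogUnit_val, dilogUnit_val, IsNilpotent.map_exp (isNilpotent_toA _ _),
    ← exp_op (isNilpotent_toA _ _)]
  congr 1
  rw [trunc, trunc, map_sum, map_sum, map_sum, Finset.op_sum]
  refine Finset.sum_nbij' NPlus.swap NPlus.swap ?_ ?_ (fun p _ => swap_swap p)
    (fun p _ => swap_swap p) ?_
  · intro q hq; rwa [NPlus.mem_degLE, deg_swap, ← NPlus.mem_degLE]
  · intro q hq; rwa [NPlus.mem_degLE, deg_swap, ← NPlus.mem_degLE]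
  · intro q _
    rw [map_smul, map_smul, map_smul, op_smul, dilogSeries_swap, swapHom, liftA_X]

/-- Two arrangements sorted by `r` differ only by exchanging elements related both ways, whose
images commute. -/
theorem prod_eq_of_perm_of_pairwise {α M : Type*} [Monoid M] (f : α → M) (r : α → α → Prop)
    (hf : ∀ a b, r a b → r b a → Commute (f a) (f b)) {L L' : List α}
    (hp : L.Perm L') (hL : L.Pairwise r) (hL' : L'.Pairwise r) :
    (L.map f).prod = (L'.map f).prod := by
  induction L generalizing L' with
  | nil => rw [List.nil_perm.1 hp]
  | cons a L ih =>
    obtain ⟨s, t, rfl⟩ := List.append_of_mem (hp.subset List.mem_cons_self)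
    have hp' : L.Perm (s ++ t) := (hp.trans List.perm_middle).cons_inv
    rw [List.pairwise_cons] at hL
    have h1 := ih hp' hL.2 (hL'.sublist (by simp))
    have hc : Commute (f a) (s.map f).prod := by
      refine Commute.list_prod_right _ _ fun x hx => ?_
      obtain ⟨b, hb, rfl⟩ := List.mem_map.1 hx
      refine hf _ _ (hL.1 b (hp'.symm.subset (by simp [hb]))) ?_
      exact (List.pairwise_append.1 hL').2.2 b hb a (by simp)
    rw [List.map_cons, List.prod_cons, h1, List.map_append, List.prod_append, List.map_append,
      List.prod_append, List.map_cons, List.prod_cons, ← mul_assoc, hc.eq, mul_assoc]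

theorem form_nonpos_of_le {p q : NPlus} (h : p ≤ q) : NPlus.form p q ≤ 0 := by
  rcases (NPlus.le_def p q).1 h with h | ⟨k, -, h1, h2⟩
  · exact h.le
  · rw [NPlus.form, h1, h2]
    apply le_of_eq
    ring

-- Swapping and reversing the sorted list keeps it sorted by slope but reverses the degrees within
-- each ray. Hence the comparison uses the weaker relation `form p q ≤ 0`, whose ties commute.
open MulOpposite in
theorem swapHom_ordProd (l : ℕ) (u : NPlus → ℚ) :
    swapHom l (ordProd l l u) = op (ordProd l l fun p => u p.swap : A l) := by
  set S := (NPlus.degLE l).sort (· ≤ ·)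
  have hpair : S.Pairwise fun p q => NPlus.form p q ≤ 0 :=
    (Finset.pairwise_sort _ _).imp form_nonpos_of_le
  have hperm : S.Perm (S.map NPlus.swap).reverse := by
    refine List.Perm.trans ?_ (List.reverse_perm _).symm
    rw [List.perm_ext_iff_of_nodup (Finset.sort_nodup _ _)
      ((Finset.sort_nodup _ _).map (Function.LeftInverse.injective swap_swap))]
    intro p
    simp only [List.mem_map, Finset.mem_sort, NPlus.mem_degLE]
    constructor
    · intro h
      exact ⟨p.swap, by rwa [deg_swap], swap_swap p⟩
    · rintro ⟨q, hq, rfl⟩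
      rwa [deg_swap]
  have hpair' : (S.map NPlus.swap).reverse.Pairwise fun p q => NPlus.form p q ≤ 0 := by
    rw [List.pairwise_reverse, List.pairwise_map]
    refine hpair.imp fun {p q} h => ?_
    rwa [form_swap, ← form_skew]
  have key := prod_eq_of_perm_of_pairwise (fun p => (dilogUnit l p (u p.swap) : A l))
    (fun p q => NPlus.form p q ≤ 0)
    (fun p q h h' => dilogUnit_commute (le_antisymm h (by rw [form_skew]; linarith)) _ _)
    hperm hpair hpair'
  have e : ∀ (v : NPlus → ℚ), (ordProd l l v : A l) =
      (S.map fun p => (dilogUnit l p (v p) : A l)).prod := fun v => by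
    rw [ordProd, ← Units.coeHom_apply, map_list_prod, List.map_map]
    rfl
  rw [e, e, key, map_list_prod, List.map_map]
  apply unop_injective
  rw [unop_list_prod, unop_op]
  simp only [List.map_reverse, List.map_map, Function.comp_def, swapHom_dilogUnit, unop_op,
    swap_swap]

-- The anti-automorphism exchanges `e₁` and `e₂` and reverses the two factors, so it sends the
-- anti-ordered product for `(m, n)` to the one for `(n, m)`.
open MulOpposite in
theorem IsOrderedProduct.swap {m n : ℕ} {u : NPlus → ℚ}
    (h : IsOrderedProduct (antiOrdered m n) u) :
    IsOrderedProduct (antiOrdered n m) fun p => u p.swap := by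
  rw [isOrderedProduct_iff] at *
  intro l
  have e : ∀ a b : ℕ, (((antiOrdered a b).1 l : (A l)ˣ) : A l) =
      dilogUnit l NPlus.e₂ b * dilogUnit l NPlus.e₁ a := fun a b => rfl
  apply Units.ext
  apply op_injective
  rw [← swapHom_ordProd, ← h l, e, e, map_mul, swapHom_dilogUnit, swapHom_dilogUnit, ← op_mul]
  rfl

theorem exponent_eq {m n : ℕ} {u : NPlus → ℚ} (h : IsOrderedProduct (antiOrdered m n) u)
    (p : NPlus) : exponent p m n = u p := by
  have hex : ∃ u : NPlus → ℚ, IsOrderedProduct (antiOrdered m n) u := ⟨u, h⟩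
  rw [exponent, dif_pos hex,
    (existsUnique_isOrderedProduct (antiOrdered_mem_logDerSubgroup m n)).unique hex.choose_spec h]

end

end RankTwoCSD

theorem mainTheorem7 :
    (∀ m n : ℕ, ∃! u : RankTwoCSD.NPlus → ℚ,
      RankTwoCSD.IsOrderedProduct (RankTwoCSD.antiOrdered m n) u) ∧
    ∀ (a b : ℕ) (hab : 0 < a + b) (hba : 0 < b + a) (m n : ℕ),
      RankTwoCSD.exponent ⟨a, b, hab⟩ m n = RankTwoCSD.exponent ⟨b, a, hba⟩ n m := by
  have hex := fun m n : ℕ =>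
    RankTwoCSD.existsUnique_isOrderedProduct (RankTwoCSD.antiOrdered_mem_logDerSubgroup m n)
  refine ⟨hex, fun a b hab hba m n => ?_⟩
  obtain ⟨u, hu, -⟩ := hex m n
  rw [RankTwoCSD.exponent_eq hu, RankTwoCSD.exponent_eq hu.swap]
  rfl
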